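/- A trinomial over $\mathrm{GF}(2)$ is a polynomial in $\mathrm{GF}(2)[x]$ with exactly three nonzero terms. A polynomial $P \in \mathrm{GF}(2)[x]$ of degree $n$ is called almost irreducible with exponent $r$ and increment $\delta = n - r$ if $P(0) \neq 0$ and $P$ has an irreducible factor in $\mathrm{GF}(2)[x]$ of degree $r$, where $r > n/2$. Theorem. If $T \in \mathrm{GF}(2)[x]$ is an almost irreducible trinomial with exponent $2976221$ and increment $\delta$, then $\delta \notin \{0,1,2,4\}$. -/

import Mathlib

open Polynomial

/-- A trinomial over `GF(2)`: a polynomial with exactly three nonzero terms. -/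
def IsTrinomial (P : (ZMod 2)[X]) : Prop :=
  P.support.card = 3

/-- `P`, a polynomial over `GF(2)` of degree `n`, is almost irreducible with exponent `r` and
increment `δ`: `P(0) ≠ 0`, and `P` has an irreducible factor of degree `r`, where `r > n / 2`
and `δ = n - r`. -/
structure IsAlmostIrreducible (P : (ZMod 2)[X]) (r δ : ℕ) : Prop where
  eval_zero_ne_zero : P.eval 0 ≠ 0
  exists_irreducible_factor : ∃ D : (ZMod 2)[X], Irreducible D ∧ D ∣ P ∧ D.natDegree = r
  natDegree_lt : P.natDegree < 2 * r
  natDegree_eq : P.natDegree = r + δ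

/-- If `∏ (X - a i)` is the image of an integer polynomial `f`, then the elementary symmetric
functions of `a` are, up to sign, the coefficients of `f`. -/
theorem aeval_esymm_of_prod_X_sub_C {n : ℕ} (f : ℤ[X]) {R : Type*} [CommRing R] (a : Fin n → R)
    (ha : ∏ i, (X - C (a i)) = f.map (Int.castRingHom R)) {j : ℕ} (hj : j ≤ n) :
    MvPolynomial.aeval a (MvPolynomial.esymm (Fin n) ℤ j)
      = (((-1) ^ j * f.coeff (n - j) : ℤ) : R) := by
  rw [MvPolynomial.aeval_esymm_eq_multiset_esymm]
  have h := Multiset.prod_X_sub_C_coeff (Finset.univ.val.map a) (k := n - j) (by simp)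
  have h2 : (Multiset.map (fun t => X - C t) (Finset.univ.val.map a)).prod
      = ∏ i, (X - C (a i)) := by
    rw [Multiset.map_map]; rfl
  rw [h2, ha] at h
  simp only [coeff_map, Multiset.card_map, Finset.card_val, Finset.card_univ, Fintype.card_fin,
    Nat.sub_sub_self hj, eq_intCast] at h
  push_cast
  rw [h, ← mul_assoc, ← mul_pow]
  simp

/-- A symmetric integer polynomial takes an integer value at the roots of a monic integer
polynomial, and this value is compatible with all base changes. -/
theorem exists_int_aeval_of_isSymmetric {n : ℕ} (f : ℤ[X]) (p : MvPolynomial (Fin n) ℤ)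
    (hp : p.IsSymmetric) : ∃ s : ℤ, ∀ {R : Type} [CommRing R] (a : Fin n → R),
      ∏ i, (X - C (a i)) = f.map (Int.castRingHom R) → MvPolynomial.aeval a p = (s : R) := by
  obtain ⟨q, hq⟩ := MvPolynomial.esymmAlgHom_surjective (σ := Fin n) ℤ (n := n) (by simp) ⟨p, hp⟩
  have hq' := congrArg Subtype.val hq
  rw [MvPolynomial.esymmAlgHom_apply] at hq'
  refine ⟨MvPolynomial.aeval (fun j : Fin n => (-1) ^ (j + 1 : ℕ) * f.coeff (n - (j + 1))) q, ?_⟩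
  intro R _ a ha
  simp only at hq'
  rw [← hq', ← AlgHom.comp_apply, MvPolynomial.comp_aeval]
  have hcast : ∀ z : ℤ, (z : R) = algebraMap ℤ R z := fun z => by simp
  rw [hcast, ← Algebra.ofId_apply, ← AlgHom.comp_apply, MvPolynomial.comp_aeval]
  congr 2
  ext j
  rw [aeval_esymm_of_prod_X_sub_C f a ha (by omega), Algebra.ofId_apply, hcast]

/-! ### Sums and products over unordered pairs of roots. -/

/-- The unordered pairs of distinct elements of `Fin n`. -/
def offDiagPairs (n : ℕ) : Finset (Sym2 (Fin n)) := Finset.univ.filter fun e => ¬ e.IsDiag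

theorem mem_offDiagPairs {n : ℕ} {e : Sym2 (Fin n)} : e ∈ offDiagPairs n ↔ ¬ e.IsDiag := by
  simp [offDiagPairs]

theorem card_offDiagPairs (n : ℕ) : (offDiagPairs n).card = n.choose 2 := by
  have := Sym2.card_subtype_not_diag (α := Fin n)
  rw [Fintype.card_fin] at this
  rw [← this, offDiagPairs, Fintype.card_subtype]

theorem image_map_offDiagPairs {n : ℕ} (σ : Equiv.Perm (Fin n)) :
    (offDiagPairs n).image (Sym2.map σ) = offDiagPairs n := by
  apply Finset.eq_of_subset_of_card_le
  · intro e he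
    obtain ⟨e', he', rfl⟩ := Finset.mem_image.1 he
    rw [mem_offDiagPairs] at he' ⊢
    rwa [Sym2.isDiag_map σ.injective]
  · rw [Finset.card_image_of_injective _ (Sym2.map.injective σ.injective)]

theorem sum_offDiagPairs_map {n : ℕ} {M : Type*} [AddCommMonoid M] (σ : Equiv.Perm (Fin n))
    (g : Sym2 (Fin n) → M) : ∑ e ∈ offDiagPairs n, g (e.map σ) = ∑ e ∈ offDiagPairs n, g e := by
  conv_rhs => rw [← image_map_offDiagPairs σ]
  rw [Finset.sum_image fun x _ y _ h => Sym2.map.injective σ.injective h]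

theorem sum_offDiagPairs {n : ℕ} {M : Type*} [AddCommMonoid M] (g : Sym2 (Fin n) → M) :
    ∑ e ∈ offDiagPairs n, g e = ∑ j, ∑ i ∈ Finset.Iio j, g s(i, j) := by
  have h := Finset.sum_sym2_filter_not_isDiag (Finset.univ : Finset (Fin n)) g
  have h1 : (Finset.univ : Finset (Fin n)).sym2.filter (fun e => ¬ e.IsDiag) = offDiagPairs n := by
    ext; simp [offDiagPairs]
  rw [h1] at h
  rw [h, Finset.sum_sigma']
  refine Finset.sum_nbij' (fun x => ⟨x.2, x.1⟩) (fun x => (x.2, x.1)) ?_ ?_ ?_ ?_ ?_ <;>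
    simp +contextual [ne_of_lt]

theorem prod_offDiagPairs {n : ℕ} {M : Type*} [CommMonoid M] (g : Sym2 (Fin n) → M) :
    ∏ e ∈ offDiagPairs n, g e = ∏ j, ∏ i ∈ Finset.Iio j, g s(i, j) :=
  sum_offDiagPairs (M := Additive M) g

/-- The product of `a i + a j` over all unordered pairs. -/
def pairSumProd {R : Type*} [CommRing R] {n : ℕ} (a : Fin n → R) : R :=
  ∏ e ∈ offDiagPairs n, (e.map a).add

/-- The sum over all unordered pairs of `a i * a j` times the product of the `(a k + a l) ^ 2`
over all other pairs. -/
def pairMulSum {R : Type*} [CommRing R] {n : ℕ} (a : Fin n → R) : R :=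
  ∑ e ∈ offDiagPairs n, (e.map a).mul * ∏ e' ∈ (offDiagPairs n).erase e, (e'.map a).add ^ 2

theorem pairSumProd_comp_perm {R : Type*} [CommRing R] {n : ℕ} (a : Fin n → R)
    (σ : Equiv.Perm (Fin n)) : pairSumProd (a ∘ σ) = pairSumProd a := by
  simp only [pairSumProd, ← Sym2.map_map]
  exact sum_offDiagPairs_map (M := Additive R) σ fun e => (e.map a).add

theorem pairMulSum_comp_perm {R : Type*} [CommRing R] {n : ℕ} (a : Fin n → R)
    (σ : Equiv.Perm (Fin n)) : pairMulSum (a ∘ σ) = pairMulSum a := by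
  rw [pairMulSum, pairMulSum]
  conv_rhs => rw [← sum_offDiagPairs_map σ]
  refine Finset.sum_congr rfl fun e _ => ?_
  rw [Sym2.map_map]
  congr 1
  conv_rhs => rw [← image_map_offDiagPairs σ]
  rw [← Finset.image_erase (Sym2.map.injective σ.injective),
    Finset.prod_image fun x _ y _ h => Sym2.map.injective σ.injective h]
  simp only [Sym2.map_map]

theorem map_pairSumProd {R S : Type*} [CommRing R] [CommRing S] (φ : R →+* S) {n : ℕ}
    (a : Fin n → R) : φ (pairSumProd a) = pairSumProd (φ ∘ a) := by
  rw [pairSumProd, pairSumProd, map_prod]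
  refine Finset.prod_congr rfl fun e _ => ?_
  induction e with | _ i j => simp [Sym2.add]

theorem map_pairMulSum {R S : Type*} [CommRing R] [CommRing S] (φ : R →+* S) {n : ℕ}
    (a : Fin n → R) : φ (pairMulSum a) = pairMulSum (φ ∘ a) := by
  have h1 : ∀ e : Sym2 (Fin n), φ (e.map a).add = (e.map (φ ∘ a)).add := fun e => by
    induction e with | _ i j => simp [Sym2.add]
  have h2 : ∀ e : Sym2 (Fin n), φ (e.map a).mul = (e.map (φ ∘ a)).mul := fun e => by
    induction e with | _ i j => simp [Sym2.mul]
  simp only [pairMulSum, map_sum, map_mul, map_prod, map_pow, h1, h2]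

/-- One integer serves all rings at once: this carries information from the roots in characteristic
0 to those in characteristic 2. -/
theorem exists_int_pairSumProd {n : ℕ} (f : ℤ[X]) : ∃ s : ℤ, ∀ {R : Type} [CommRing R]
    (a : Fin n → R), ∏ i, (X - C (a i)) = f.map (Int.castRingHom R) → pairSumProd a = (s : R) := by
  obtain ⟨s, hs⟩ := exists_int_aeval_of_isSymmetric f
    (pairSumProd (MvPolynomial.X : Fin n → MvPolynomial (Fin n) ℤ)) (fun σ => by
      rw [← AlgHom.coe_toRingHom, map_pairSumProd]
      convert! pairSumProd_comp_perm _ σ using 2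
      ext1 i; simp)
  refine ⟨s, fun a ha => ?_⟩
  rw [← hs a ha, ← AlgHom.coe_toRingHom, map_pairSumProd]
  congr 1
  ext1 i; simp

theorem exists_int_pairMulSum {n : ℕ} (f : ℤ[X]) : ∃ s : ℤ, ∀ {R : Type} [CommRing R]
    (a : Fin n → R), ∏ i, (X - C (a i)) = f.map (Int.castRingHom R) → pairMulSum a = (s : R) := by
  obtain ⟨s, hs⟩ := exists_int_aeval_of_isSymmetric f
    (pairMulSum (MvPolynomial.X : Fin n → MvPolynomial (Fin n) ℤ)) (fun σ => by
      rw [← AlgHom.coe_toRingHom, map_pairMulSum]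
      convert! pairMulSum_comp_perm _ σ using 2
      ext1 i; simp)
  refine ⟨s, fun a ha => ?_⟩
  rw [← hs a ha, ← AlgHom.coe_toRingHom, map_pairMulSum]
  congr 1
  ext1 i; simp

/-! ### Expansions modulo 8. -/

/-- The factors for (i, j) and (j, i) multiply to -(a i - a j)^2, rewritten so that its behaviour
modulo powers of 2 is visible. -/
theorem prod_prod_erase_sub {R : Type*} [CommRing R] {n : ℕ} (a : Fin n → R) :
    ∏ i, ∏ j ∈ Finset.univ.erase i, (a i - a j)
      = ∏ e ∈ offDiagPairs n, (4 * (e.map a).mul - (e.map a).add ^ 2) := by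
  rw [prod_offDiagPairs]
  have h : ∀ i : Fin n, ∏ j ∈ Finset.univ.erase i, (a i - a j)
      = (∏ j ∈ Finset.Iio i, (a i - a j)) * ∏ j ∈ Finset.Ioi i, (a i - a j) := fun i => by
    rw [← Finset.prod_union]
    · congr 1
      ext j
      simp
    · rw [Finset.disjoint_left]
      intro j h1 h2
      simp at h1 h2
      exact absurd h1 h2.not_gt
  have h2 : ∏ i, ∏ j ∈ Finset.Ioi i, (a i - a j) = ∏ j, ∏ i ∈ Finset.Iio j, (a i - a j) :=
    Finset.prod_comm' (by simp)
  simp only [h]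
  rw [Finset.prod_mul_distrib, h2, ← Finset.prod_mul_distrib]
  refine Finset.prod_congr rfl fun j _ => ?_
  rw [← Finset.prod_mul_distrib]
  refine Finset.prod_congr rfl fun i _ => ?_
  simp [Sym2.mul, Sym2.add]
  ring

theorem exists_prod_sub_four_mul {R ι : Type*} [CommRing R] [DecidableEq ι] (s : Finset ι)
    (u v : ι → R) : ∃ w, ∏ e ∈ s, (4 * v e - u e)
      = (-1) ^ s.card * (∏ e ∈ s, u e - 4 * ∑ e ∈ s, v e * ∏ e' ∈ s.erase e, u e') + 8 * w := by
  induction s using Finset.induction_on with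
  | empty => exact ⟨0, by simp⟩
  | insert e s he ih =>
    obtain ⟨w, hw⟩ := ih
    have h : ∀ x ∈ s, v x * ∏ e' ∈ (insert e s).erase x, u e'
        = u e * (v x * ∏ e' ∈ s.erase x, u e') := fun x hx => by
      have hne : e ≠ x := fun h => he (h ▸ hx)
      rw [Finset.erase_insert_of_ne hne, Finset.prod_insert (by simp [he])]
      ring
    rw [Finset.prod_insert he, Finset.prod_insert he, Finset.sum_insert he,
      Finset.card_insert_of_notMem he, Finset.erase_insert he, Finset.sum_congr rfl h,
      ← Finset.mul_sum, hw]
    exact ⟨-(-1) ^ s.card * 2 * v e * (∑ x ∈ s, v x * ∏ e' ∈ s.erase x, u e')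
      + (4 * v e - u e) * w, by ring⟩

theorem exists_prod_prod_erase_sub {R : Type*} [CommRing R] {n : ℕ} (a : Fin n → R) :
    ∃ w, ∏ i, ∏ j ∈ Finset.univ.erase i, (a i - a j)
      = (-1) ^ n.choose 2 * (pairSumProd a ^ 2 - 4 * pairMulSum a) + 8 * w := by
  obtain ⟨w, hw⟩ := exists_prod_sub_four_mul (offDiagPairs n) (fun e => (e.map a).add ^ 2)
    (fun e => (e.map a).mul)
  refine ⟨w, ?_⟩
  rw [prod_prod_erase_sub, hw, card_offDiagPairs, pairSumProd, pairMulSum, Finset.prod_pow]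

/-- Here q is the second elementary symmetric function of the t i, given by Newton's formula; the
factor m ^ 2 avoids the exponent `s.card - 2`. -/
theorem exists_prod_add_two_mul {R ι : Type*} [CommRing R] [DecidableEq ι] (s : Finset ι)
    (m : R) (t : ι → R) : ∃ q z, 2 * q = (∑ i ∈ s, t i) ^ 2 - ∑ i ∈ s, t i ^ 2 ∧
      m ^ 2 * ∏ i ∈ s, (m + 2 * t i)
        = m ^ s.card * (m ^ 2 + 2 * m * ∑ i ∈ s, t i + 4 * q) + 8 * z := by
  induction s using Finset.induction_on with
  | empty => exact ⟨0, 0, by simp, by simp⟩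
  | insert e s he ih =>
    obtain ⟨q, z, hq, hz⟩ := ih
    rw [Finset.prod_insert he, Finset.sum_insert he, Finset.sum_insert he,
      Finset.card_insert_of_notMem he]
    refine ⟨q + t e * ∑ i ∈ s, t i, m ^ s.card * t e * q + z * (m + 2 * t e), ?_, ?_⟩
    · linear_combination hq
    · linear_combination (m + 2 * t e) * hz

/-! ### The discriminant of a trinomial in characteristic 0. -/

theorem exists_prod_X_sub_C_eq {L : Type*} [Field L] [IsAlgClosed L] {g : L[X]} (hg : g.Monic)
    {n : ℕ} (hn : g.natDegree = n) : ∃ a : Fin n → L, ∏ i, (X - C (a i)) = g := by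
  have hs := (IsAlgClosed.splits g).eq_prod_roots_of_monic hg
  have hc : g.roots.toList.length = n := by
    rw [Multiset.length_toList, ← (IsAlgClosed.splits g).natDegree_eq_card_roots, hn]
  subst hc
  refine ⟨fun i => g.roots.toList.get i, ?_⟩
  conv_rhs => rw [hs]
  conv_rhs => rw [← Multiset.coe_toList g.roots]
  rw [Multiset.map_coe, Multiset.prod_coe, ← List.prod_ofFn]
  congr 1
  apply List.ext_get <;> simp

theorem trinomial_monic_natDegree {R : Type*} [CommRing R] [Nontrivial R] {n k : ℕ} (hk : k < n) :
    (X ^ n + X ^ k + 1 : R[X]).Monic ∧ (X ^ n + X ^ k + 1 : R[X]).natDegree = n := by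
  have h : (X ^ k + 1 : R[X]).degree < n := by
    refine lt_of_le_of_lt (degree_add_le _ _) (max_lt ?_ ?_)
    · rw [degree_X_pow]; exact_mod_cast hk
    · rw [degree_one]; exact_mod_cast (by omega : 0 < n)
  rw [add_assoc]
  exact ⟨monic_X_pow_add h, natDegree_eq_of_degree_eq_some (by
    rw [degree_add_eq_left_of_degree_lt] <;> simp [h])⟩

theorem exists_integralClosure_roots {n k : ℕ} (hk : k < n) :
    ∃ a : Fin n → integralClosure ℤ ℂ, ∏ i, (X - C (a i)) = X ^ n + X ^ k + 1 := by
  obtain ⟨hm, hd⟩ := trinomial_monic_natDegree (R := ℂ) hk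
  obtain ⟨a, ha⟩ := exists_prod_X_sub_C_eq hm hd
  have hint : ∀ i, IsIntegral ℤ (a i) := fun i => by
    refine ⟨X ^ n + X ^ k + 1, (trinomial_monic_natDegree hk).1, ?_⟩
    have := congrArg (eval (a i)) ha
    rw [eval_prod, Finset.prod_eq_zero (Finset.mem_univ i) (by simp)] at this
    simpa using this.symm
  refine ⟨fun i => ⟨a i, hint i⟩, ?_⟩
  apply map_injective (algebraMap (integralClosure ℤ ℂ) ℂ) Subtype.val_injective
  rw [Polynomial.map_prod]
  simpa using ha

/-- The quotient is rational and integral, hence an integer; congruences between algebraic integers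
thus descend to ℤ. -/
theorem int_dvd_of_integralClosure {m c : ℤ} (hc : c ≠ 0) {z : integralClosure ℤ ℂ}
    (h : (m : integralClosure ℤ ℂ) = c * z) : c ∣ m := by
  have hz : IsIntegral ℤ (z : ℂ) := z.2
  have h' : (m : ℂ) = c * (z : ℂ) := by
    have := congrArg (Subtype.val) h
    simpa using this
  have hc' : (c : ℂ) ≠ 0 := by exact_mod_cast hc
  have hzq : (z : ℂ) = algebraMap ℚ ℂ (m / c) := by
    rw [map_div₀]
    simp only [eq_ratCast, Rat.cast_intCast]
    rw [h']; field_simp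
  rw [hzq, isIntegral_algebraMap_iff (algebraMap ℚ ℂ).injective] at hz
  obtain ⟨y, hy⟩ := IsIntegrallyClosed.isIntegral_iff.1 hz
  refine ⟨y, ?_⟩
  have hcq : (c : ℚ) ≠ 0 := by exact_mod_cast hc
  have : (y : ℚ) = m / c := by simpa using hy
  rw [eq_div_iff hcq] at this
  exact_mod_cast (by rw [← this]; ring : (m : ℚ) = c * y)

/-- Only e_(n-k) and e_n survive among the positive-degree elementary symmetric functions, so
Newton's identities propagate nonzero power sums only along the semigroup generated by n - k and n.
-/
theorem sum_pow_eq_zero_of_trinomial {n k : ℕ} (hk0 : 0 < k) (hk : k < n) {R : Type*} [CommRing R]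
    (a : Fin n → R) (ha : ∏ i, (X - C (a i)) = X ^ n + X ^ k + 1) (j : ℕ)
    (hj : ∀ x y, j ≠ x * (n - k) + y * n) : ∑ i, a i ^ j = 0 := by
  have ha' : ∏ i, (X - C (a i)) = (X ^ n + X ^ k + 1 : ℤ[X]).map (Int.castRingHom R) := by
    simpa using ha
  have he : ∀ i, 0 < i → i ≠ n - k → i ≠ n →
      MvPolynomial.aeval a (MvPolynomial.esymm (Fin n) ℤ i) = 0 := by
    intro i hi0 hi1 hi2
    rcases le_or_gt i n with hi | hi
    · rw [aeval_esymm_of_prod_X_sub_C _ a ha' hi]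
      have : (X ^ n + X ^ k + 1 : ℤ[X]).coeff (n - i) = 0 := by
        simp only [coeff_add, coeff_X_pow, coeff_one]
        rw [if_neg (by omega), if_neg (by omega), if_neg (by omega)]; rfl
      simp [this]
    · rw [MvPolynomial.esymm, Finset.powersetCard_eq_empty.2 (by simpa using hi)]
      simp
  induction j using Nat.strong_induction_on with
  | _ j ih =>
    have hj0 : 0 < j := Nat.pos_of_ne_zero fun h => hj 0 0 (by simp [h])
    have hN := congrArg (MvPolynomial.aeval a) (MvPolynomial.psum_eq_mul_esymm_sub_sum (Fin n) ℤ j hj0)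
    rw [map_sub, map_mul, he j hj0 (fun h => hj 1 0 (by omega)) (fun h => hj 0 1 (by omega)),
      map_sum, Finset.sum_eq_zero] at hN
    · simpa [MvPolynomial.psum] using hN
    · rintro ⟨x, y⟩ hxy
      obtain ⟨hxy, hx0, hxj⟩ := Finset.mem_filter.1 hxy
      replace hxy : x + y = j := Finset.HasAntidiagonal.mem_antidiagonal.1 hxy
      replace hx0 : 0 < x := hx0
      replace hxj : x < j := hxj
      simp only [map_mul]
      by_cases h1 : x = n - k
      · have := ih y (by omega) (fun u v h => hj (u + 1) v (by rw [add_mul]; omega))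
        simp [MvPolynomial.psum, this]
      by_cases h2 : x = n
      · have := ih y (by omega) (fun u v h => hj u (v + 1) (by rw [add_mul]; omega))
        simp [MvPolynomial.psum, this]
      · rw [he x hx0 h1 h2]; simp

/-- At a root a, a f'(a) = n a^n + k a^k = -(n + (n - k) a^k); the signs cancel because n is odd and
the roots have product -1. -/
theorem prod_derivative_trinomial {n k h : ℕ} (hn : Odd n) (hnk : n = k + 2 * h) {R : Type*}
    [CommRing R] (hk0 : 0 < k) (hh : 0 < h)
    (a : Fin n → R) (ha : ∏ i, (X - C (a i)) = X ^ n + X ^ k + 1) :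
    ∏ i, ∏ j ∈ Finset.univ.erase i, (a i - a j) = ∏ i, ((n : R) + 2 * (h * a i ^ k)) := by
  have hroot : ∀ i, a i ^ n + a i ^ k + 1 = 0 := fun i => by
    have := congrArg (eval (a i)) ha
    rw [eval_prod, Finset.prod_eq_zero (Finset.mem_univ i) (by simp)] at this
    simpa using this.symm
  have hprod : ∏ i, a i = -1 := by
    have := congrArg (eval 0) ha
    rw [eval_prod] at this
    have hn0 : n ≠ 0 := by omega
    simp [Finset.prod_neg, hk0.ne', hn0, hn.neg_one_pow] at this
    linear_combination -this
  have hder : ∀ i, ∏ j ∈ Finset.univ.erase i, (a i - a j) = n * a i ^ (n - 1) + k * a i ^ (k - 1) := by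
    intro i
    have h1 := Lagrange.eval_nodal_derivative_eval_node_eq (v := a) (Finset.mem_univ i)
    rw [Lagrange.eval_nodal, Lagrange.nodal, ha] at h1
    rw [← h1]
    simp only [derivative_add, derivative_X_pow, derivative_one, eval_add, eval_mul, eval_C,
      eval_pow, eval_X, add_zero]
  have hmul : ∀ i, a i * ∏ j ∈ Finset.univ.erase i, (a i - a j)
      = -((n : R) + 2 * (h * a i ^ k)) := by
    intro i
    have e1 : a i * a i ^ (n - 1) = a i ^ n := by rw [← pow_succ']; congr 1; omega
    have e2 : a i * a i ^ (k - 1) = a i ^ k := by rw [← pow_succ']; congr 1; omega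
    have e3 : (n : R) = k + 2 * h := by rw [hnk]; push_cast; ring
    rw [hder]
    linear_combination (n : R) * e1 + (k : R) * e2 + (n : R) * hroot i - (a i ^ k) * e3
  have := Finset.prod_congr (rfl : (Finset.univ : Finset (Fin n)) = Finset.univ) fun i _ => hmul i
  rw [Finset.prod_mul_distrib, hprod, Finset.prod_neg, Finset.card_univ, Fintype.card_fin,
    hn.neg_one_pow] at this
  linear_combination -this

/-- The discriminant congruence modulo `8` for a trinomial `X ^ n + X ^ k + 1` with `n`, `k` odd. -/
theorem dvd_discr_trinomial {n k : ℕ} (hn : Odd n) (hk : Odd k) (hkn : k < n)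
    (hdvd : ¬ (n - k) ∣ 2 * n) {d s : ℤ}
    (hd : ∀ a : Fin n → integralClosure ℤ ℂ, ∏ i, (X - C (a i)) = X ^ n + X ^ k + 1 →
      pairSumProd a = d)
    (hs : ∀ a : Fin n → integralClosure ℤ ℂ, ∏ i, (X - C (a i)) = X ^ n + X ^ k + 1 →
      pairMulSum a = s) :
    (8 : ℤ) ∣ n ^ 2 * ((-1) ^ n.choose 2 * (d ^ 2 - 4 * s)) - n ^ n * n ^ 2 := by
  obtain ⟨a, ha⟩ := exists_integralClosure_roots hkn
  obtain ⟨h, hh⟩ : ∃ h, n = k + 2 * h := by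
    obtain ⟨x, rfl⟩ := hn; obtain ⟨y, rfl⟩ := hk
    exact ⟨x - y, by omega⟩
  have hk0 : 0 < k := hk.pos
  have hpar : ∀ x y : ℕ, n = x * (n - k) + y * n → y ≠ 0 := by
    rintro x y hxy rfl
    have : n = 2 * (x * h) := by
      rw [show n - k = 2 * h by omega] at hxy
      rw [hxy]; ring
    have := Nat.odd_iff.1 hn
    omega
  have hpark : ∀ x : ℕ, k ≠ x * (n - k) := by
    intro x hx
    have h2 : k = 2 * (x * h) := by
      rw [show n - k = 2 * h by omega] at hx
      rw [hx]; ring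
    have := Nat.odd_iff.1 hk
    omega
  have hp1 : ∑ i, a i ^ k = 0 := by
    apply sum_pow_eq_zero_of_trinomial hk0 hkn a ha
    intro x y hxy
    rcases Nat.eq_zero_or_pos y with rfl | hy
    · exact hpark x (by omega)
    · have := Nat.le_mul_of_pos_left n hy
      omega
  have hp2 : ∑ i, a i ^ (2 * k) = 0 := by
    apply sum_pow_eq_zero_of_trinomial hk0 hkn a ha
    -- With y = 0, n - k divides 2k and hence 2n; with y = 1, n would be a multiple of the even
    -- number n - k; with y ≥ 2 the right side exceeds 2k.
    intro x y hxy
    obtain rfl | rfl | hy : y = 0 ∨ y = 1 ∨ 2 ≤ y := by omega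
    · apply hdvd
      exact ⟨x + 2, by rw [mul_add, mul_comm _ x]; omega⟩
    · have : n = (x + 2) * (n - k) + 0 * n := by rw [add_mul]; omega
      exact hpar _ _ this rfl
    · have := Nat.mul_le_mul_right n hy
      omega
  obtain ⟨w, hw⟩ := exists_prod_prod_erase_sub a
  obtain ⟨q, z, hq, hz⟩ := exists_prod_add_two_mul Finset.univ (n : integralClosure ℤ ℂ)
    (fun i => (h : integralClosure ℤ ℂ) * a i ^ k)
  have hq0 : q = 0 := by
    have e : ∀ i, ((h : integralClosure ℤ ℂ) * a i ^ k) ^ 2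
        = (h : integralClosure ℤ ℂ) ^ 2 * a i ^ (2 * k) := fun i => by ring
    simp only [e] at hq
    rw [← Finset.mul_sum, ← Finset.mul_sum, hp1, hp2] at hq
    simpa using hq
  rw [← Finset.mul_sum, hp1, hq0, Finset.card_univ, Fintype.card_fin,
    ← prod_derivative_trinomial hn hh hk0 (by omega) a ha, hw, hd a ha, hs a ha] at hz
  apply int_dvd_of_integralClosure (z := z - n ^ 2 * w) (by norm_num)
  push_cast
  linear_combination hz

/-! ### Berlekamp's discriminant and the sign of Frobenius. -/

/-- The nontrivial additive character of `ZMod 2` with integer values. -/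
def zmodTwoSign (x : ZMod 2) : ℤ := if x = 0 then 1 else -1

theorem zmodTwoSign_add : ∀ x y, zmodTwoSign (x + y) = zmodTwoSign x * zmodTwoSign y := by
  decide

theorem zmodTwoSign_sum {ι : Type*} (s : Finset ι) (f : ι → ZMod 2) :
    zmodTwoSign (∑ i ∈ s, f i) = ∏ i ∈ s, zmodTwoSign (f i) := by
  classical
  induction s using Finset.induction_on with
  | empty => rfl
  | insert e s he ih => rw [Finset.sum_insert he, Finset.prod_insert he, zmodTwoSign_add, ih]

/-- Berlekamp's discriminant in characteristic two: the sum over unordered pairs of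
`a i * a j / (a i + a j) ^ 2`. -/
def berlekampDiscr {K : Type*} [Field K] {n : ℕ} (a : Fin n → K) : K :=
  ∑ e ∈ offDiagPairs n, (e.map a).mul / (e.map a).add ^ 2

theorem add_ne_zero_of_injective {K : Type*} [Field K] [CharP K 2] {n : ℕ} {a : Fin n → K}
    (ha : Function.Injective a) {i j : Fin n} (hij : i ≠ j) : a i + a j ≠ 0 := by
  intro h
  exact hij (ha (CharTwo.add_eq_zero.1 h))

/-- Put g(i, j) = a i / (a i + a j). As g(i, j) + g(j, i) = 1, the signs of l(g(i, j)) form an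
antisymmetric function, whose product over pairs changes by sign σ under σ. Since σ replaces g by
g^2, the change is measured by the sum of g + g^2 = a i a j / (a i + a j)^2, which is B. -/
theorem sign_frobenius_eq {K : Type*} [Field K] [CharP K 2] [Algebra (ZMod 2) K] {n : ℕ}
    {a : Fin n → K} (ha : Function.Injective a) {σ : Equiv.Perm (Fin n)}
    (hσ : ∀ i, a (σ i) = a i ^ 2) (l : K →ₗ[ZMod 2] ZMod 2) (hl : l 1 = 1) :
    (Equiv.Perm.sign σ : ℤ) = zmodTwoSign (l (berlekampDiscr a)) := by
  set g : Fin n → Fin n → K := fun i j => a i / (a i + a j) with hg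
  have hgg : ∀ i j, i ≠ j → g i j = g j i + 1 := fun i j hij => by
    have h := add_ne_zero_of_injective ha hij
    have h2 : (2 : K) = 0 := CharTwo.two_eq_zero
    simp only [hg]
    rw [add_comm (a j) (a i)]
    field_simp
    linear_combination (-a j) * h2
  set f : Fin n → Fin n → ℤ := fun i j => if i = j then 0 else zmodTwoSign (l (g i j)) with hf
  have hff : ∀ i j, f i j = -f j i := fun i j => by
    by_cases hij : i = j
    · simp [hf, hij]
    · simp only [hf, if_neg hij, if_neg (Ne.symm hij)]
      rw [hgg i j hij, map_add, hl, zmodTwoSign_add]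
      simp [zmodTwoSign]
  have key := σ.prod_Iio_comp_eq_sign_mul_prod hff
  have e1 : ∏ j, ∏ i ∈ Finset.Iio j, f i j
      = zmodTwoSign (l (∑ j, ∑ i ∈ Finset.Iio j, g i j)) := by
    simp only [map_sum, zmodTwoSign_sum]
    refine Finset.prod_congr rfl fun j _ => Finset.prod_congr rfl fun i hi => ?_
    simp only [hf, if_neg (Finset.mem_Iio.1 hi).ne]
  have e2 : ∏ j, ∏ i ∈ Finset.Iio j, f (σ i) (σ j)
      = zmodTwoSign (l (∑ j, ∑ i ∈ Finset.Iio j, g (σ i) (σ j))) := by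
    simp only [map_sum, zmodTwoSign_sum]
    refine Finset.prod_congr rfl fun j _ => Finset.prod_congr rfl fun i hi => ?_
    simp only [hf, if_neg (fun h => (Finset.mem_Iio.1 hi).ne (σ.injective h))]
  have hsq : ∀ x, zmodTwoSign x * zmodTwoSign x = 1 := by decide
  have hB : berlekampDiscr a = (∑ j, ∑ i ∈ Finset.Iio j, g (σ i) (σ j))
      + ∑ j, ∑ i ∈ Finset.Iio j, g i j := by
    rw [berlekampDiscr, sum_offDiagPairs, ← Finset.sum_add_distrib]
    refine Finset.sum_congr rfl fun j _ => ?_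
    rw [← Finset.sum_add_distrib]
    refine Finset.sum_congr rfl fun i hi => ?_
    have h := add_ne_zero_of_injective ha (Finset.mem_Iio.1 hi).ne
    have h2 : (2 : K) = 0 := CharTwo.two_eq_zero
    simp only [hg, hσ, Sym2.map_mk, Sym2.mul_mk, Sym2.add_mk, ← CharTwo.add_sq]
    field_simp
    linear_combination (-a i ^ 2) * h2
  rw [e1, e2] at key
  rw [hB, map_add, zmodTwoSign_add, key, mul_assoc, hsq]
  simp

theorem sign_frobenius_of_berlekampDiscr {K : Type*} [Field K] [CharP K 2] [Algebra (ZMod 2) K]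
    {n : ℕ} {a : Fin n → K} (ha : Function.Injective a) {σ : Equiv.Perm (Fin n)}
    (hσ : ∀ i, a (σ i) = a i ^ 2) :
    (berlekampDiscr a = 0 → Equiv.Perm.sign σ = 1) ∧
      (berlekampDiscr a = 1 → Equiv.Perm.sign σ = -1) := by
  obtain ⟨l, hl⟩ := Module.Projective.exists_dual_eq_one (ZMod 2) (one_ne_zero (α := K))
  have h := sign_frobenius_eq ha hσ l hl
  constructor <;> intro hB <;> rw [hB] at h
  · rw [map_zero] at h
    exact Units.ext h
  · rw [hl] at h
    exact Units.ext h

theorem pairMulSum_eq {K : Type*} [Field K] [CharP K 2] {n : ℕ} {a : Fin n → K}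
    (ha : Function.Injective a) :
    pairSumProd a ≠ 0 ∧ pairMulSum a = pairSumProd a ^ 2 * berlekampDiscr a := by
  have hne : ∀ e ∈ offDiagPairs n, (e.map a).add ≠ 0 := fun e he => by
    induction e with
    | _ i j =>
      rw [mem_offDiagPairs] at he
      exact add_ne_zero_of_injective ha he
  refine ⟨Finset.prod_ne_zero_iff.2 hne, ?_⟩
  rw [pairMulSum, pairSumProd, berlekampDiscr, Finset.mul_sum]
  refine Finset.sum_congr rfl fun e he => ?_
  rw [Finset.prod_pow, ← Finset.mul_prod_erase _ _ he]
  have := hne e he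
  field_simp

/-! ### Swan's theorem for trinomials of odd degree. -/

theorem prod_X_sub_C_eq_trinomial {K : Type*} [Field K] {n k : ℕ} (hkn : k < n) {a : Fin n → K}
    (ha : Function.Injective a) (hroot : ∀ i, a i ^ n + a i ^ k + 1 = 0) :
    ∏ i, (X - C (a i)) = X ^ n + X ^ k + 1 := by
  obtain ⟨hm, hd⟩ := trinomial_monic_natDegree (R := K) hkn
  have hm1 : (∏ i, (X - C (a i))).Monic := monic_prod_of_monic _ _ fun i _ => monic_X_sub_C _
  have hd1 : (∏ i, (X - C (a i))).natDegree = n := by simp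
  have hdeg : (∏ i, (X - C (a i))).degree = (n : WithBot ℕ) := by
    rw [degree_eq_natDegree hm1.ne_zero, hd1]
  refine eq_of_degree_sub_lt_of_eval_index_eq Finset.univ (v := a) ha.injOn ?_ fun i _ => ?_
  · rw [Finset.card_univ, Fintype.card_fin, ← hdeg]
    refine degree_sub_lt_left ?_ hm1.ne_zero (by rw [hm1.leadingCoeff, hm.leadingCoeff])
    rw [hdeg, degree_eq_natDegree hm.ne_zero, hd]
  · rw [eval_prod, Finset.prod_eq_zero (Finset.mem_univ i) (by simp)]
    simp [hroot i]

/-- As d^2 = n^2 = 1 modulo 8, the congruence reads ±(1 - 4s) = n^n. For n = 7 both signs are -1, so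
4s = 0; for n = 5 it is 1 - 4s = 5. -/
theorem even_odd_of_discr_congruence {n : ℕ} {d s : ℤ} (hd : Odd d)
    (h : (8 : ℤ) ∣ n ^ 2 * ((-1) ^ n.choose 2 * (d ^ 2 - 4 * s)) - n ^ n * n ^ 2) :
    (n % 8 = 7 → Even s) ∧ (n % 8 = 5 → Odd s) := by
  have h8 := (ZMod.intCast_zmod_eq_zero_iff_dvd _ 8).2 h
  push_cast at h8
  have hd1 : (d : ZMod 8) ^ 2 = 1 := by
    obtain ⟨x, rfl⟩ := hd
    push_cast
    generalize (x : ZMod 8) = y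
    revert y; decide
  rw [hd1] at h8
  have hev : Even s → (4 * s : ZMod 8) = 0 := by
    rintro ⟨x, rfl⟩
    push_cast
    generalize (x : ZMod 8) = y
    revert y; decide
  have hodd : Odd s → (4 * s : ZMod 8) = 4 := by
    rintro ⟨x, rfl⟩
    push_cast
    generalize (x : ZMod 8) = y
    revert y; decide
  constructor
  · intro hn
    obtain ⟨m, rfl⟩ : ∃ m, n = 8 * m + 7 := ⟨n / 8, by omega⟩
    have hn8 : ((8 * m + 7 : ℕ) : ZMod 8) = -1 := by
      push_cast
      rw [show (8 : ZMod 8) = 0 from rfl, show (7 : ZMod 8) = -1 from rfl]; ring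
    have hc : (8 * m + 7).choose 2 = 2 * (16 * m ^ 2 + 26 * m + 10) + 1 := by
      rw [Nat.choose_two_right, show 8 * m + 7 - 1 = 2 * (4 * m + 3) by omega]
      rw [Nat.div_eq_of_eq_mul_left (by norm_num)]
      ring
    have hodd7 : Odd (8 * m + 7) := ⟨4 * m + 3, by ring⟩
    rw [hn8, Odd.neg_one_pow ⟨_, hc⟩, hodd7.neg_one_pow] at h8
    by_contra hs
    rw [Int.not_even_iff_odd] at hs
    rw [hodd hs] at h8
    simp only [even_two.neg_pow, one_pow] at h8
    revert h8; decide
  · intro hn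
    obtain ⟨m, rfl⟩ : ∃ m, n = 8 * m + 5 := ⟨n / 8, by omega⟩
    have hn8 : ((8 * m + 5 : ℕ) : ZMod 8) = 5 := by
      push_cast
      rw [show (8 : ZMod 8) = 0 from rfl]; ring
    have hc : (8 * m + 5).choose 2 = 2 * (16 * m ^ 2 + 18 * m + 5) := by
      rw [Nat.choose_two_right, show 8 * m + 5 - 1 = 2 * (4 * m + 2) by omega]
      rw [Nat.div_eq_of_eq_mul_left (by norm_num)]
      ring
    have hpow : (5 : ZMod 8) ^ (8 * m + 5) = 5 := by
      rw [show 8 * m + 5 = 2 * (4 * m + 2) + 1 by ring, pow_succ, pow_mul,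
        show (5 : ZMod 8) ^ 2 = 1 from rfl, one_pow, one_mul]
    rw [hn8, hc, pow_mul, hpow, neg_one_sq, one_pow] at h8
    by_contra hs
    rw [Int.not_odd_iff_even] at hs
    rw [hev hs] at h8
    revert h8; decide

theorem sign_frobenius_trinomial_of_odd {n k : ℕ} (hn : Odd n) (hk : Odd k) (hkn : k < n)
    (hdvd : ¬ (n - k) ∣ 2 * n) {K : Type} [Field K] [CharP K 2] [Algebra (ZMod 2) K]
    {a : Fin n → K} (ha : Function.Injective a) (hroot : ∀ i, a i ^ n + a i ^ k + 1 = 0)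
    {σ : Equiv.Perm (Fin n)} (hσ : ∀ i, a (σ i) = a i ^ 2) :
    (n % 8 = 7 → Equiv.Perm.sign σ = 1) ∧ (n % 8 = 5 → Equiv.Perm.sign σ = -1) := by
  obtain ⟨d, hd⟩ := exists_int_pairSumProd (n := n) (X ^ n + X ^ k + 1)
  obtain ⟨s, hs⟩ := exists_int_pairMulSum (n := n) (X ^ n + X ^ k + 1)
  have hmap : ∀ (R : Type) [CommRing R],
      (X ^ n + X ^ k + 1 : ℤ[X]).map (Int.castRingHom R) = X ^ n + X ^ k + 1 := fun R _ => by simp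
  have hprod := prod_X_sub_C_eq_trinomial hkn ha hroot
  have h8 := dvd_discr_trinomial hn hk hkn hdvd (fun a ha => hd a (by rw [ha, hmap]))
    (fun a ha => hs a (by rw [ha, hmap]))
  obtain ⟨hne, hB⟩ := pairMulSum_eq ha
  rw [hd a (by rw [hprod, hmap])] at hne hB
  rw [hs a (by rw [hprod, hmap])] at hB
  have hev : ∀ z : ℤ, Even z → (z : K) = 0 := fun z hz => by
    obtain ⟨x, rfl⟩ := hz
    push_cast
    exact CharTwo.add_self_eq_zero _
  have hod : ∀ z : ℤ, Odd z → (z : K) = 1 := fun z hz => by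
    obtain ⟨x, rfl⟩ := hz
    push_cast
    rw [CharTwo.two_eq_zero]; ring
  have hdo : Odd d := by
    rw [← Int.not_even_iff_odd]
    exact fun h => hne (hev d h)
  rw [hod d hdo, one_pow, one_mul] at hB
  obtain ⟨h7, h5⟩ := even_odd_of_discr_congruence hdo h8
  obtain ⟨g0, g1⟩ := sign_frobenius_of_berlekampDiscr ha hσ
  exact ⟨fun h => g0 (by rw [← hB, hev s (h7 h)]), fun h => g1 (by rw [← hB, hod s (h5 h)])⟩

/-- **Swan's theorem** for trinomials of odd degree over a field of characteristic two, in terms of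
the sign of the Frobenius permutation of the roots. -/
theorem sign_frobenius_trinomial {n k : ℕ} (hn : Odd n) (hk0 : 0 < k) (hkn : k < n)
    (hdvd : ∀ m, Even m → m = k ∨ m = n - k → ¬ m ∣ 2 * n) {K : Type} [Field K] [CharP K 2]
    [Algebra (ZMod 2) K] {a : Fin n → K} (ha : Function.Injective a)
    (hroot : ∀ i, a i ^ n + a i ^ k + 1 = 0) {σ : Equiv.Perm (Fin n)}
    (hσ : ∀ i, a (σ i) = a i ^ 2) :
    (n % 8 = 7 → Equiv.Perm.sign σ = 1) ∧ (n % 8 = 5 → Equiv.Perm.sign σ = -1) := by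
  rcases Nat.even_or_odd k with hk | hk
  -- For k even, pass to the reciprocal trinomial, whose roots are the inverses and whose middle
  -- exponent n - k is odd.
  · refine sign_frobenius_trinomial_of_odd (k := n - k) (a := fun i => (a i)⁻¹) hn
      (Nat.Odd.sub_even hkn.le hn hk) (by omega) ?_ (fun i j h => ha (inv_injective h)) ?_ ?_
    · rw [Nat.sub_sub_self hkn.le]
      exact hdvd k hk (Or.inl rfl)
    · intro i
      have h0 : a i ≠ 0 := fun h => by
        have := hroot i
        rw [h, zero_pow (by omega), zero_pow hk0.ne'] at this
        simp at this
      have e : a i ^ n = a i ^ k * a i ^ (n - k) := by rw [← pow_add]; congr 1; omega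
      have := hroot i
      rw [inv_pow, inv_pow]
      have h1 := pow_ne_zero n h0
      have h2 := pow_ne_zero (n - k) h0
      field_simp
      rw [e] at this ⊢
      linear_combination a i ^ (n - k) * this
    · intro i
      simp only [hσ, inv_pow]
  · exact sign_frobenius_trinomial_of_odd hn hk hkn
      (hdvd _ (Nat.Odd.sub_odd hn hk) (Or.inr rfl)) ha hroot hσ

/-! ### Frobenius as a permutation of the roots, and its sign from a factorization. -/

/-- A repeated root a would satisfy a f'(a) = a^n + k a^k = 0, incompatible with a^n + a^k + 1 = 0
for either parity of k. -/
theorem injective_of_prod_X_sub_C_eq_trinomial {K : Type*} [Field K] [CharP K 2] {n k : ℕ}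
    (hn : Odd n) (hk0 : 0 < k) {a : Fin n → K}
    (ha : ∏ i, (X - C (a i)) = X ^ n + X ^ k + 1) : Function.Injective a := by
  intro i j hij
  by_contra hne
  have hroot : a i ^ n + a i ^ k + 1 = 0 := by
    have := congrArg (eval (a i)) ha
    rw [eval_prod, Finset.prod_eq_zero (Finset.mem_univ i) (by simp)] at this
    simpa using this.symm
  have hder := Lagrange.eval_nodal_derivative_eval_node_eq (v := a) (Finset.mem_univ i)
  rw [Lagrange.eval_nodal, Lagrange.nodal, ha, Finset.prod_eq_zero
    (Finset.mem_erase.2 ⟨Ne.symm hne, Finset.mem_univ j⟩) (sub_eq_zero.2 hij)] at hder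
  simp only [derivative_add, derivative_X_pow, derivative_one, eval_add, eval_mul, eval_C,
    eval_pow, eval_X, add_zero] at hder
  have hn1 : (n : K) = 1 := by
    obtain ⟨m, rfl⟩ := hn
    push_cast
    rw [CharTwo.two_eq_zero]; ring
  have e1 : a i * a i ^ (n - 1) = a i ^ n := by
    rw [← pow_succ']; congr 1; have := hn.pos; omega
  have e2 : a i * a i ^ (k - 1) = a i ^ k := by rw [← pow_succ']; congr 1; omega
  have h1 : a i ^ n + k * a i ^ k = 0 := by
    rw [hn1] at hder
    linear_combination a i * hder - e1 - k * e2
  rcases Nat.even_or_odd k with hk | hk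
  · obtain ⟨m, rfl⟩ := hk
    push_cast at h1
    rw [CharTwo.add_self_eq_zero, zero_mul, add_zero] at h1
    have h0 : a i = 0 := pow_eq_zero_iff (hn.pos.ne') |>.1 h1
    rw [h0, zero_pow hn.pos.ne', zero_pow hk0.ne'] at hroot
    simp at hroot
  · have hk1 : (k : K) = 1 := by
      obtain ⟨m, rfl⟩ := hk
      push_cast
      rw [CharTwo.two_eq_zero]; ring
    rw [hk1, one_mul] at h1
    rw [h1] at hroot
    simp at hroot

theorem exists_frobenius_perm_trinomial (K : Type*) [Field K] [IsAlgClosed K] [CharP K 2] {n k : ℕ}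
    (hn : Odd n) (hk0 : 0 < k) (hkn : k < n) :
    ∃ (a : Fin n → K) (σ : Equiv.Perm (Fin n)), Function.Injective a ∧
      (∀ i, a i ^ n + a i ^ k + 1 = 0) ∧ (∀ x, x ^ n + x ^ k + 1 = 0 → ∃ i, a i = x) ∧
      ∀ i, a (σ i) = a i ^ 2 := by
  obtain ⟨hm, hd⟩ := trinomial_monic_natDegree (R := K) hkn
  obtain ⟨a, ha⟩ := exists_prod_X_sub_C_eq hm hd
  have hinj := injective_of_prod_X_sub_C_eq_trinomial hn hk0 ha
  have hroot : ∀ x, x ^ n + x ^ k + 1 = 0 ↔ ∃ i, a i = x := fun x => by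
    have := congrArg (eval x) ha
    simp only [eval_prod, eval_sub, eval_X, eval_C, eval_add, eval_pow, eval_one] at this
    rw [← this, Finset.prod_eq_zero_iff]
    simp only [Finset.mem_univ, true_and, sub_eq_zero, eq_comm]
  have hr := fun i => (hroot (a i)).2 ⟨i, rfl⟩
  have hsq : ∀ i, ∃ j, a j = a i ^ 2 := fun i => (hroot _).1 (by
    have := congrArg (· ^ 2) (hr i)
    simp only [CharTwo.add_sq, one_pow] at this
    rw [← pow_mul, ← pow_mul, mul_comm 2, mul_comm 2, pow_mul, pow_mul, this]
    simp)
  choose g hg using hsq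
  have hginj : Function.Injective g := fun i j hij => hinj (by
    have : a i ^ 2 = a j ^ 2 := by rw [← hg, ← hg, hij]
    exact CharTwo.sq_injective this)
  exact ⟨a, Equiv.ofBijective g (Finite.injective_iff_bijective.1 hginj), hinj, hr,
    fun x => (hroot x).1, hg⟩

theorem frobenius_perm_pow_apply {K : Type*} [Monoid K] {n : ℕ} {a : Fin n → K}
    {σ : Equiv.Perm (Fin n)} (hσ : ∀ i, a (σ i) = a i ^ 2) (m : ℕ) (i : Fin n) :
    a ((σ ^ m) i) = a i ^ 2 ^ m := by
  induction m with
  | zero => simp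
  | succ m ih => rw [pow_succ', Equiv.Perm.mul_apply, hσ, ih, ← pow_mul, pow_succ]

theorem sign_pow_of_odd {n : ℕ} (σ : Equiv.Perm (Fin n)) {r : ℕ} (hr : Odd r) :
    Equiv.Perm.sign (σ ^ r) = Equiv.Perm.sign σ := by
  rw [map_pow, Int.units_pow_eq_pow_mod_two, Nat.odd_iff.1 hr, pow_one]

theorem sign_frobenius_eq_one {K : Type*} [Monoid K] {n r : ℕ} (hr : Odd r) {a : Fin n → K}
    (ha : Function.Injective a) {σ : Equiv.Perm (Fin n)} (hσ : ∀ i, a (σ i) = a i ^ 2)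
    (h : ∀ i, a i ^ 2 ^ r = a i) : Equiv.Perm.sign σ = 1 := by
  have : σ ^ r = 1 := Equiv.ext fun i => ha (by
    rw [frobenius_perm_pow_apply hσ, h, Equiv.Perm.one_apply])
  rw [← sign_pow_of_odd σ hr, this, map_one]

theorem cube_eq_one {K : Type*} [CommRing K] {x : K} (h : x ^ 2 + x + 1 = 0) :
    x ^ 3 = 1 := by
  linear_combination (x - 1) * h

/-- The odd power σ ^ r has the sign of σ. It fixes the roots lying in GF(2^r) and, as 2^r ≡ 2 mod
3, swaps the two primitive cube roots of unity: it is a transposition. -/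
theorem sign_frobenius_eq_neg_one {K : Type*} [Field K] [CharP K 2] {n r : ℕ} (hr : Odd r)
    {a : Fin n → K} (ha : Function.Injective a) {σ : Equiv.Perm (Fin n)}
    (hσ : ∀ i, a (σ i) = a i ^ 2) (h : ∀ i, a i ^ 2 ^ r = a i ∨ a i ^ 2 + a i + 1 = 0)
    {i : Fin n} (hi : a i ^ 2 + a i + 1 = 0) : Equiv.Perm.sign σ = -1 := by
  have h2 : (2 : K) = 0 := CharTwo.two_eq_zero
  have hne : i ≠ σ i := fun he => by
    have e := hσ i
    rw [← he] at e
    have : (1 : K) = 0 := by linear_combination hi + e - a i * h2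
    exact one_ne_zero this
  have hpow : a i ^ 2 ^ r = a i ^ 2 := by
    obtain ⟨m, rfl⟩ := hr
    have h4 : 4 ^ m % 3 = 1 := by rw [Nat.pow_mod]; simp
    obtain ⟨t, ht⟩ : ∃ t, 2 ^ (2 * m + 1) = 3 * t + 2 := by
      refine ⟨2 ^ (2 * m + 1) / 3, ?_⟩
      rw [pow_succ, pow_mul]
      norm_num
      omega
    rw [ht, pow_add, pow_mul, cube_eq_one hi, one_pow, one_mul]
  have hswap : σ ^ r = Equiv.swap i (σ i) := by
    refine Equiv.ext fun j => ha ?_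
    rw [frobenius_perm_pow_apply hσ]
    by_cases hj1 : j = i
    · rw [hj1, Equiv.swap_apply_left, hσ, hpow]
    by_cases hj2 : j = σ i
    · rw [hj2, Equiv.swap_apply_right, hσ, ← pow_mul, mul_comm, pow_mul, hpow]
      linear_combination a i * cube_eq_one hi
    rw [Equiv.swap_apply_of_ne_of_ne hj1 hj2]
    rcases h j with hj | hj
    · exact hj
    · exfalso
      -- The two roots of X^2 + X + 1 are a i and its square.
      have : (a j - a i) * (a j - a (σ i)) = 0 := by
        rw [hσ]
        linear_combination hj + cube_eq_one hi - (a j) * hi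
      rcases mul_eq_zero.1 this with h' | h'
      · exact hj1 (ha (sub_eq_zero.1 h'))
      · exact hj2 (ha (sub_eq_zero.1 h'))
  rw [← sign_pow_of_odd σ hr, hswap, Equiv.Perm.sign_swap hne]

/-! ### Roots of unity as roots of small factors. -/

theorem Irreducible.dvd_of_aeval_eq_zero_of_aeval_eq_zero {F K : Type*} [Field F] [Field K]
    [Algebra F K] {P Q : F[X]} (hP : Irreducible P) {x : K} (hx : aeval x P = 0)
    (hQ : aeval x Q = 0) : P ∣ Q := by
  have h := minpoly.dvd F x hQ
  rw [← minpoly.eq_of_irreducible hP hx] at h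
  exact (Dvd.intro _ rfl).trans h

theorem Irreducible.root_pow_card_pow_natDegree {K : Type*} [Field K] [Algebra (ZMod 2) K]
    {P : (ZMod 2)[X]} (hP : Irreducible P) {x : K} (hx : aeval x P = 0) :
    x ^ 2 ^ P.natDegree = x := by
  obtain ⟨q, hq⟩ := hP.natDegree_dvd_iff_dvd_X_pow_card_pow_sub_X.1 (dvd_refl P.natDegree)
  have := congrArg (aeval x) hq
  rw [map_mul, hx, zero_mul, Nat.card_zmod] at this
  simpa [sub_eq_zero] using this

theorem Irreducible.natDegree_le_of_root_pow_eq_one {F K : Type*} [Field F] [Field K]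
    [Algebra F K] {P : F[X]} (hP : Irreducible P) {x : K} (hx : aeval x P = 0) {m : ℕ}
    (hm : 0 < m) (hxm : x ^ m = 1) : P.natDegree ≤ m := by
  have h := natDegree_le_of_dvd (hP.dvd_of_aeval_eq_zero_of_aeval_eq_zero hx
    (Q := X ^ m - C 1) (by simp [hxm])) (X_pow_sub_C_ne_zero hm 1)
  rwa [natDegree_X_pow_sub_C] at h

theorem inv_trinomial_eq_zero {K : Type*} [Field K] {n k : ℕ} (hkn : k ≤ n) {x : K} (hx : x ≠ 0)
    (h : x ^ n + x ^ (n - k) + 1 = 0) : x⁻¹ ^ n + x⁻¹ ^ k + 1 = 0 := by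
  have e : x ^ n = x ^ k * x ^ (n - k) := by rw [← pow_add]; congr 1; omega
  have h1 := pow_ne_zero k hx
  have h2 := pow_ne_zero (n - k) hx
  rw [inv_pow, inv_pow, e]
  rw [e] at h
  field_simp
  linear_combination h

/-- A root of `X ^ n + X ^ k + 1` that is a root of unity of order dividing `m` exists as soon as
one exists for the trinomial or its reciprocal. -/
theorem exists_root_pow_eq_one {K : Type*} [Field K] {n k l m : ℕ} (hkn : k ≤ n)
    (hl : l = k ∨ l = n - k) {x : K} (hx : x ≠ 0) (hxm : x ^ m = 1) (h : x ^ n + x ^ l + 1 = 0) :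
    ∃ y : K, (y = x ∨ y = x⁻¹) ∧ y ^ m = 1 ∧ y ^ n + y ^ k + 1 = 0 := by
  rcases hl with rfl | rfl
  · exact ⟨x, Or.inl rfl, hxm, h⟩
  · exact ⟨x⁻¹, Or.inr rfl, by rw [inv_pow, hxm, inv_one], inv_trinomial_eq_zero hkn hx h⟩

theorem exists_eval_eq_zero {K : Type*} [Field K] [IsAlgClosed K] {g : K[X]}
    (hg : g.natDegree ≠ 0) : ∃ x, eval x g = 0 :=
  IsAlgClosed.exists_root g fun h => hg (natDegree_eq_of_degree_eq_some h)

theorem exists_pow_seven_eq_one (K : Type*) [Field K] [IsAlgClosed K] [CharP K 2] :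
    ∃ x : K, x ^ 3 + x ^ 2 + 1 = 0 ∧ x ^ 7 = 1 ∧ x ≠ 0 := by
  obtain ⟨x, hx⟩ := exists_eval_eq_zero (g := (X ^ 3 + X ^ 2 + 1 : K[X])) (by
    rw [(trinomial_monic_natDegree (by norm_num)).2]; norm_num)
  have h : x ^ 3 + x ^ 2 + 1 = 0 := by simpa using hx
  have h2 : (2 : K) = 0 := CharTwo.two_eq_zero
  refine ⟨x, h, ?_, ?_⟩
  · linear_combination (x ^ 4 - x ^ 3 + x ^ 2 - 2 * x + 3) * h + (-2 * x ^ 2 + x - 2) * h2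
  · rintro rfl
    simp at h

/-- The witness is a root of X^8 + X^7 + X^3 + X^2 + 1, a divisor of X^118 + X^2 + 1 over GF(2).
Repeated squaring gives x^256 = x, and 118 = 64 + 32 + 16 + 4 + 2. -/
theorem exists_pow_255_eq_one (K : Type*) [Field K] [IsAlgClosed K] [CharP K 2] :
    ∃ x : K, x ^ 118 + x ^ 2 + 1 = 0 ∧ x ^ 255 = 1 ∧ x ≠ 0 ∧ x ^ 2 + x + 1 ≠ 0 := by
  obtain ⟨x, hx⟩ := exists_eval_eq_zero (g := (X ^ 8 + X ^ 7 + X ^ 3 + X ^ 2 + 1 : K[X]))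
    (by
      have : (X ^ 8 + X ^ 7 + X ^ 3 + X ^ 2 + 1 : K[X]).natDegree = 8 := by compute_degree!
      rw [this]; norm_num)
  have h : x ^ 8 + x ^ 7 + x ^ 3 + x ^ 2 + 1 = 0 := by simpa using hx
  have h2 : (2 : K) = 0 := CharTwo.two_eq_zero
  have h0 : x ≠ 0 := by
    rintro rfl
    simp at h
  have h8 : x ^ 8 = x ^ 7 + x ^ 3 + x ^ 2 + 1 := by linear_combination (1) * h + (-x ^ 7 - x ^ 3 - x ^ 2 - 1) * h2
  have h16 : x ^ 16 = x ^ 5 + x ^ 4 + x ^ 3 + x ^ 2 + 1 := by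
    rw [show x ^ 16 = (x ^ 8) ^ 2 by ring, h8]
    linear_combination (x ^ 6 - x ^ 5 + x ^ 4 - x ^ 3 + 3 * x ^ 2 - 2 * x + 2) * h + (-x ^ 4 + x ^ 3 - 2 * x ^ 2 + x - 1) * h2
  have h32 : x ^ 32 = x ^ 6 + x ^ 5 + x ^ 4 + x ^ 3 + x ^ 2 + x + 1 := by
    rw [show x ^ 32 = (x ^ 16) ^ 2 by ring, h16]
    linear_combination (x ^ 2 + x + 2) * h + (x ^ 7 + x ^ 6 + x ^ 5 - x ^ 3 - x ^ 2 - x - 1) * h2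
  have h64 : x ^ 64 = x ^ 6 + x ^ 5 := by
    rw [show x ^ 64 = (x ^ 32) ^ 2 by ring, h32]
    linear_combination (x ^ 4 + x ^ 3 + 2 * x ^ 2 + 2 * x + 3) * h + (x ^ 7 + 2 * x ^ 6 + x ^ 5 - x ^ 3 - x ^ 2 - 1) * h2
  have h128 : x ^ 128 = x ^ 7 + x ^ 5 + x ^ 4 + x ^ 3 := by
    rw [show x ^ 128 = (x ^ 64) ^ 2 by ring, h64]
    linear_combination (x ^ 4 + x ^ 3) * h + (-x ^ 7 - x ^ 6 - x ^ 5 - x ^ 4 - x ^ 3) * h2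
  have h256 : x ^ 256 = x := by
    rw [show x ^ 256 = (x ^ 128) ^ 2 by ring, h128]
    linear_combination (x ^ 6 - x ^ 5 + 3 * x ^ 4 - x ^ 3 + 4 * x ^ 2 - 3 * x + 6) * h + (-3 * x ^ 7 - x ^ 6 - x ^ 5 - 2 * x ^ 4 - x ^ 3 - 5 * x ^ 2 + x - 3) * h2
  have h96 : x ^ 96 = x ^ 5 + x ^ 4 + x ^ 3 + x + 1 := by
    rw [show x ^ 96 = x ^ 64 * x ^ 32 by ring, h64, h32]
    linear_combination (x ^ 4 + x ^ 3 + x ^ 2 + x + 1) * h + (-x ^ 5 - 2 * x ^ 4 - 2 * x ^ 3 - x ^ 2 - x - 1) * h2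
  have h112 : x ^ 112 = x ^ 7 + x ^ 6 + x ^ 5 + x ^ 4 + 1 := by
    rw [show x ^ 112 = x ^ 96 * x ^ 16 by ring, h96, h16]
    linear_combination (x ^ 2 + x + 2) * h + (x ^ 6 + x ^ 5 - x ^ 2 - 1) * h2
  have h116 : x ^ 116 = x ^ 6 + x ^ 5 + x := by
    rw [show x ^ 116 = x ^ 112 * x ^ 4 by ring, h112]
    linear_combination (x ^ 3 + x) * h + (-x ^ 6 - x ^ 5 - x ^ 3 - x) * h2
  have h118 : x ^ 118 = x ^ 2 + 1 := by
    rw [show x ^ 118 = x ^ 116 * x ^ 2 by ring, h116]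
    linear_combination (1) * h + (-x ^ 2 - 1) * h2
  refine ⟨x, by linear_combination h118 + (x ^ 2 + 1) * h2, ?_, h0, fun hq => h0 ?_⟩
  · apply mul_left_cancel₀ h0
    linear_combination h256
  · linear_combination h - (x ^ 6 - x ^ 4 + x ^ 3 + 1) * hq + x * h2

theorem zmod_two_eq_one : ∀ c : ZMod 2, c ≠ 0 → c = 1 := by decide

theorem quadratic_eq {q : (ZMod 2)[X]} (hd : q.natDegree = 2) (h0 : eval 0 q ≠ 0)
    (h1 : eval 1 q ≠ 0) : q = X ^ 2 + X + 1 := by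
  have hq := q.as_sum_range_C_mul_X_pow
  have hl : q.coeff 2 ≠ 0 := by
    have : q.leadingCoeff ≠ 0 := leadingCoeff_ne_zero.2 fun h => by simp [h] at hd
    rwa [leadingCoeff, hd] at this
  rw [hd] at hq
  simp only [Finset.sum_range_succ, Finset.sum_range_zero, zero_add] at hq
  rw [hq] at h0 h1
  simp only [eval_add, eval_mul, eval_C, eval_pow, eval_X] at h0 h1
  rw [hq]
  generalize q.coeff 0 = c0 at *
  generalize q.coeff 1 = c1 at *
  generalize q.coeff 2 = c2 at *
  obtain rfl := zmod_two_eq_one c2 hl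
  obtain rfl : c0 = 1 := by revert h0; clear hq; revert c0 c1; decide
  obtain rfl : c1 = 1 := by revert h1; clear hq h0; revert c1; decide
  simp
  ring

/-- Four quartics are left: the three irreducible ones, whose roots lie in GF(16), and (X^2 + X +
1)^2. -/
theorem quartic_root_pow_fifteen {K : Type*} [Field K] [CharP K 2] [Algebra (ZMod 2) K]
    {q : (ZMod 2)[X]} (hd : q.natDegree = 4) (h0 : eval 0 q ≠ 0) (h1 : eval 1 q ≠ 0) {x : K}
    (hx : aeval x q = 0) : x ^ 15 = 1 := by
  have hq := q.as_sum_range_C_mul_X_pow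
  have hl : q.coeff 4 ≠ 0 := by
    have : q.leadingCoeff ≠ 0 := leadingCoeff_ne_zero.2 fun h => by simp [h] at hd
    rwa [leadingCoeff, hd] at this
  rw [hd] at hq
  simp only [Finset.sum_range_succ, Finset.sum_range_zero, zero_add] at hq
  rw [hq] at h0 h1 hx
  simp only [eval_add, eval_mul, eval_C, eval_pow, eval_X] at h0 h1
  simp only [map_add, map_mul, map_pow, aeval_X, aeval_C] at hx
  have h2 : (2 : K) = 0 := CharTwo.two_eq_zero
  have hc : ∀ c : ZMod 2, c = 0 ∨ c = 1 := by decide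
  generalize q.coeff 0 = c0 at *
  generalize q.coeff 1 = c1 at *
  generalize q.coeff 2 = c2 at *
  generalize q.coeff 3 = c3 at *
  generalize q.coeff 4 = c4 at *
  obtain rfl := zmod_two_eq_one c4 hl
  obtain rfl : c0 = 1 := (hc c0).resolve_left fun h => h0 (by rw [h]; simp)
  have hsum : c1 + c2 + c3 = 1 := by
    clear hx hq h0
    revert c1 c2 c3; decide
  clear h0 h1 hq hl
  rcases hc c1 with rfl | rfl <;> rcases hc c2 with rfl | rfl <;> rcases hc c3 with rfl | rfl <;>
    first
    | exact absurd hsum (by decide)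
    | simp only [map_one, map_zero, one_mul, zero_mul, add_zero, pow_zero, pow_one] at hx
  · linear_combination (x ^ 11 - x ^ 10 + x ^ 9 - x ^ 8 + x ^ 6 - 2 * x ^ 5 + 3 * x ^ 4
      - 3 * x ^ 3 + 2 * x ^ 2 - 3) * hx + (3 * x ^ 3 - x ^ 2 + 1) * h2
  · have hsq : x ^ 2 + x + 1 = 0 := by
      apply pow_eq_zero_iff two_ne_zero |>.1
      linear_combination hx + (x ^ 3 + x ^ 2 + x) * h2
    rw [show x ^ 15 = (x ^ 3) ^ 5 by ring, cube_eq_one hsq, one_pow]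
  · linear_combination (x ^ 11 - x ^ 8 - x ^ 7 + x ^ 5 + 2 * x ^ 4 + x ^ 3 - x ^ 2 - 3 * x - 3) * hx
      + (2 * x ^ 2 + 3 * x + 1) * h2
  · linear_combination (x ^ 11 - x ^ 10 + x ^ 6 - x ^ 5 + x - 1) * hx

/-! ### Excluding the increments. -/

theorem IsTrinomial.exists_eq {T : (ZMod 2)[X]} (hT : IsTrinomial T) (h0 : eval 0 T ≠ 0) :
    ∃ n k, 0 < k ∧ k < n ∧ T = X ^ n + X ^ k + 1 := by
  obtain ⟨l, k, n, hlk, hkn, x, y, z, hx, hy, hz, rfl⟩ := card_support_eq_three.1 hT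
  obtain rfl := zmod_two_eq_one x hx
  obtain rfl := zmod_two_eq_one y hy
  obtain rfl := zmod_two_eq_one z hz
  have hl : l = 0 := by
    by_contra hl
    apply h0
    have hk : k ≠ 0 := by omega
    have hn : n ≠ 0 := by omega
    simp [hl, hk, hn]
  subst hl
  exact ⟨n, k, hlk, hkn, by simp only [map_one, one_mul, pow_zero]; ring⟩

/-- By Swan's theorem, an irreducible trinomial of prime degree congruent to `5` modulo `8` has
middle exponent `2` up to reciprocals; if the degree is `3` modulo `7`, it then has a cubic factor. -/
theorem not_irreducible_trinomial {n k : ℕ} (hp : n.Prime) (hn8 : n % 8 = 5) (hn7 : n % 7 = 3)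
    (hk0 : 0 < k) (hkn : k < n) : ¬ Irreducible (X ^ n + X ^ k + 1 : (ZMod 2)[X]) := by
  intro hirr
  let K := AlgebraicClosure (ZMod 2)
  have hodd : Odd n := Nat.odd_iff.2 (by omega)
  have hdeg := (trinomial_monic_natDegree (R := ZMod 2) hkn).2
  have hrt : ∀ x : K, x ^ n + x ^ k + 1 = 0 → aeval x (X ^ n + X ^ k + 1 : (ZMod 2)[X]) = 0 :=
    fun x hx => by simpa using hx
  by_cases hdvd : ∀ m, Even m → m = k ∨ m = n - k → ¬ m ∣ 2 * n
  · obtain ⟨a, σ, ha, hroot, -, hσ⟩ := exists_frobenius_perm_trinomial K hodd hk0 hkn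
    have h1 : Equiv.Perm.sign σ = 1 := sign_frobenius_eq_one hodd ha hσ fun i => by
      conv_lhs => rw [← hdeg]
      exact hirr.root_pow_card_pow_natDegree (hrt _ (hroot i))
    have h2 := (sign_frobenius_trinomial hodd hk0 hkn hdvd ha hroot hσ).2 hn8
    rw [h1] at h2
    exact absurd h2 (by decide)
  · push Not at hdvd
    obtain ⟨m, ⟨e, rfl⟩, hm, hd⟩ := hdvd
    rw [← two_mul] at hm hd
    have he : e ∣ n := Nat.dvd_of_mul_dvd_mul_left two_pos hd
    -- The alternative e = n is too large, since 2 * e is k or n - k.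
    have he1 : e = 1 := ((Nat.dvd_prime hp).1 he).resolve_right (by omega)
    subst he1
    obtain ⟨x, hx3, hx7, hx0⟩ := exists_pow_seven_eq_one K
    obtain ⟨t, rfl⟩ : ∃ t, n = 7 * t + 3 := ⟨n / 7, by omega⟩
    obtain ⟨y, -, hy7, hy⟩ := exists_root_pow_eq_one hkn.le hm hx0 hx7 (by
      rw [pow_add, pow_mul, hx7, one_pow, one_mul, mul_one, hx3])
    have := hirr.natDegree_le_of_root_pow_eq_one (hrt y hy) (by norm_num) hy7
    rw [hdeg] at this
    have : 7 * t + 3 = 5 := by omega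
    omega

/-- Both primes in 2976223 = 23 · 129401 are 2 modulo 3, so only 1 and the full product are 1 modulo
3. -/
theorem eq_one_of_dvd_of_mod_three {e : ℕ} (he : e ∣ 2976223) (h3 : 2 * e % 3 = 2)
    (hlt : e ≠ 2976223) : e = 1 := by
  have hp1 : Nat.Prime 23 := by norm_num
  have hp2 : Nat.Prime 129401 := by norm_num
  rw [show 2976223 = 23 * 129401 by norm_num] at he
  obtain ⟨y, z, hy, hz, rfl⟩ := (Nat.dvd_mul).1 he
  rcases (Nat.dvd_prime hp1).1 hy with rfl | rfl <;> rcases (Nat.dvd_prime hp2).1 hz with rfl | rfl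
  all_goals omega

theorem trinomial_ne_irreducible_mul_quadratic {n k r : ℕ} (hn : n = 2976223) (hr : n = r + 2)
    (hk0 : 0 < k) (hkn : k < n) {D : (ZMod 2)[X]} (hD : Irreducible D) (hDr : D.natDegree = r) :
    (X ^ n + X ^ k + 1 : (ZMod 2)[X]) ≠ D * (X ^ 2 + X + 1) := by
  intro hT
  let K := AlgebraicClosure (ZMod 2)
  have hoddn : Odd n := Nat.odd_iff.2 (by omega)
  have hoddr : Odd r := Nat.odd_iff.2 (by omega)
  have hrt : ∀ x : K, x ^ n + x ^ k + 1 = 0 ↔ aeval x D = 0 ∨ x ^ 2 + x + 1 = 0 := fun x => by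
    have := congrArg (aeval x) hT
    simp only [map_add, map_mul, map_pow, aeval_X, map_one] at this
    rw [this, mul_eq_zero]
  obtain ⟨w, hw⟩ := exists_eval_eq_zero (g := (X ^ 2 + X ^ 1 + 1 : K[X])) (by
    rw [(trinomial_monic_natDegree (by norm_num)).2]; norm_num)
  replace hw : w ^ 2 + w + 1 = 0 := by simpa using hw
  have hwT := (hrt w).2 (Or.inr hw)
  have hw3 := cube_eq_one hw
  -- A primitive cube root of unity w is a root of T and n ≡ 1 mod 3, so w + w^k + 1 = 0.
  have hk3 : k % 3 = 2 := by
    have h2 : (2 : K) = 0 := CharTwo.two_eq_zero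
    obtain ⟨t, ht⟩ : ∃ t, n = 3 * t + 1 := ⟨n / 3, by omega⟩
    rw [← Nat.div_add_mod k 3] at hwT
    rw [ht, pow_add, pow_mul, pow_add, pow_mul, hw3, one_pow, one_pow, one_mul, one_mul] at hwT
    have hlt := Nat.mod_lt k (by norm_num : 3 > 0)
    interval_cases h : k % 3
    · exfalso
      rw [pow_zero, pow_one] at hwT
      have hw0 : w = 0 := by linear_combination hwT - h2
      rw [hw0] at hw
      simp at hw
    · exfalso
      have : (1 : K) = 0 := by linear_combination hwT - w * h2
      exact one_ne_zero this
    · rfl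
  by_cases hdvd : ∀ m, Even m → m = k ∨ m = n - k → ¬ m ∣ 2 * n
  · obtain ⟨a, σ, ha, hroot, hall, hσ⟩ := exists_frobenius_perm_trinomial K hoddn hk0 hkn
    obtain ⟨i, hi⟩ := hall w hwT
    have h1 : Equiv.Perm.sign σ = -1 := sign_frobenius_eq_neg_one hoddr ha hσ (fun j => by
      rcases (hrt _).1 (hroot j) with h | h
      · left
        rw [← hDr]
        exact hD.root_pow_card_pow_natDegree h
      · exact Or.inr h) (i := i) (by rw [hi, hw])
    have h2 := (sign_frobenius_trinomial hoddn hk0 hkn hdvd ha hroot hσ).1 (by omega)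
    rw [h1] at h2
    exact absurd h2 (by decide)
  · push Not at hdvd
    obtain ⟨m, ⟨e, rfl⟩, hm, hd⟩ := hdvd
    rw [← two_mul] at hm hd
    have he : e ∣ n := Nat.dvd_of_mul_dvd_mul_left two_pos hd
    -- Both k and n - k are 2 modulo 3, hence so is 2 * e; and 2 * e < n rules out e = n.
    have he1 : e = 1 := eq_one_of_dvd_of_mod_three (hn ▸ he) (by omega) (by omega)
    subst he1
    obtain ⟨x, hx, hx255, hx0, hxq⟩ := exists_pow_255_eq_one K
    obtain ⟨y, hyx, hy255, hy⟩ := exists_root_pow_eq_one hkn.le hm hx0 hx255 (by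
      obtain ⟨t, ht⟩ : ∃ t, n = 255 * t + 118 := ⟨n / 255, by omega⟩
      rw [ht, pow_add, pow_mul, hx255, one_pow, one_mul, mul_one, hx])
    rcases (hrt y).1 hy with h | h
    · have := hD.natDegree_le_of_root_pow_eq_one h (by norm_num) hy255
      omega
    · apply hxq
      rcases hyx with rfl | rfl
      · exact h
      -- X^2 + X + 1 is self-reciprocal.
      · linear_combination x ^ 2 * h - (x * x⁻¹ + 1 + x) * mul_inv_cancel₀ hx0

theorem theorem6p2 (T : (ZMod 2)[X]) (hT : IsTrinomial T) (δ : ℕ)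
    (h : IsAlmostIrreducible T 2976221 δ) : δ ∉ ({0, 1, 2, 4} : Set ℕ) := by
  obtain ⟨r, hr⟩ : ∃ r : ℕ, r = 2976221 := ⟨_, rfl⟩
  rw [← hr] at h
  obtain ⟨h0, ⟨D, hD, ⟨q, hq⟩, hDr⟩, -, hdeg⟩ := h
  obtain ⟨n, k, hk0, hkn, rfl⟩ := hT.exists_eq h0
  obtain ⟨hm, hn⟩ := trinomial_monic_natDegree (R := ZMod 2) hkn
  rw [hn] at hdeg
  have hD0 := hD.ne_zero
  have hqne : q ≠ 0 := by
    rintro rfl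
    rw [mul_zero] at hq
    exact hm.ne_zero hq
  have hqδ : q.natDegree = δ := by
    have := natDegree_mul hD0 hqne
    rw [← hq, hn, hDr] at this
    omega
  have hq0 : eval 0 q ≠ 0 := fun he => h0 (by rw [hq, eval_mul, he, mul_zero])
  have hq1 : eval 1 q ≠ 0 := fun he => by
    have := congrArg (eval 1) hq
    rw [eval_mul, he, mul_zero] at this
    simp only [eval_add, eval_pow, eval_X, one_pow, eval_one] at this
    exact absurd this (by decide)
  simp only [Set.mem_insert_iff, Set.mem_singleton_iff]
  rintro (rfl | rfl | rfl | rfl)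
  · rw [add_zero] at hdeg
    refine not_irreducible_trinomial (n := n) ?_ (by omega) (by omega) hk0 hkn ?_
    · rw [hdeg, hr]; norm_num
    · rw [hq, irreducible_mul_isUnit]
      · exact hD
      · rw [isUnit_iff_degree_eq_zero]
        rw [degree_eq_natDegree hqne, hqδ]
        rfl
  · obtain ⟨x, hx⟩ := exists_root_of_degree_eq_one
      ((degree_eq_iff_natDegree_eq_of_pos one_pos).2 hqδ)
    have hx01 : ∀ x : ZMod 2, x = 0 ∨ x = 1 := by decide
    rcases hx01 x with rfl | rfl
    · exact hq0 hx
    · exact hq1 hx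
  · rw [quadratic_eq hqδ hq0 hq1] at hq
    exact trinomial_ne_irreducible_mul_quadratic (by omega) hdeg hk0 hkn hD hDr hq
  · obtain ⟨x, hx⟩ := IsAlgClosed.exists_aeval_eq_zero (AlgebraicClosure (ZMod 2)) q (by
      intro hd
      have := natDegree_eq_zero_iff_degree_le_zero.2 hd.le
      omega)
    have h15 := quartic_root_pow_fifteen hqδ hq0 hq1 hx
    have hT := congrArg (aeval x) hq
    rw [map_mul, hx, mul_zero] at hT
    simp only [map_add, map_pow, aeval_X, map_one] at hT
    -- Here n = 2976225 = 15 · 198415.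
    obtain ⟨t, ht⟩ : ∃ t, n = 15 * t := ⟨n / 15, by omega⟩
    rw [ht, pow_mul, h15, one_pow] at hT
    have h2 : (2 : AlgebraicClosure (ZMod 2)) = 0 := CharTwo.two_eq_zero
    have hxk : x ^ k = 0 := by linear_combination hT - h2
    rw [pow_eq_zero_iff hk0.ne'] at hxk
    rw [hxk] at h15
    simp at h15
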